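/- Let $\mathbb K$ be a field, $V$ a finite-dimensional $\mathbb K$-vector space of dimension $\ell$, and $\mathcal A$ a finite set of linear hyperplanes of $V$ (a central arrangement, possibly empty). Let $L(\mathcal A)$ be the set of all intersections of subsets of $\mathcal A$, the empty intersection being $V$. For $X\in L(\mathcal A)$ let $\mathcal A^X=\{X\cap H \mid H\in\mathcal A,\ X\not\subseteq H\}$, an arrangement in $X$. For $H_0\in\mathcal A$ put $\mathcal A'=\mathcal A\setminus\{H_0\}$ and $\mathcal A''=\mathcal A^{H_0}$. Let $S=S(V^*)$ be the symmetric algebra of $V^*$, and for $H\in\mathcal A$ let $\alpha_H\in V^*$ have kernel $H$. Let $D(\mathcal A)=\{\theta\in\mathrm{Der}_{\mathbb K}(S)\mid \theta(\alpha_H)\in\alpha_H S \text{ for all } H\in\mathcal A\}$. The arrangement $\mathcal A$ is free with exponents $\exp\mathcal A=\{b_1,\dots,b_\ell\}$ (a multiset) if the $S$-module $D(\mathcal A)$ has a basis $\theta_1,\dots,\theta_\ell$ such that $\theta_i(V^*)\subseteq S_{b_i}$ for every $i$, where $S_b$ is the homogeneous component of $S$ of degree $b$. The class of inductively free arrangements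 is the smallest class of central arrangements in finite-dimensional $\mathbb K$-vector spaces such that * all empty arrangements belong to it; * if for some $H_0\in\mathcal A$ both $\mathcal A'$ and $\mathcal A''$ belong to it and are free with $\exp\mathcal A''\subseteq\exp\mathcal A'$ (as multisets), then $\mathcal A$ belongs to it. The class of inductive factorizations is the smallest class of pairs $(\mathcal A,\pi)$, with $\mathcal A$ such an arrangement and $\pi$ a partition of $\mathcal A$ into non-empty blocks, such that * every empty arrangement together with its empty partition belongs to it; * $(\mathcal A,\pi)$ belongs to it if there are a block $\pi_1$ of $\pi$ and a hyperplane $H_0\in\pi_1$ such that the map $\varrho:\mathcal A\setminus\pi_1\to\mathcal A''$, $H\mapsto H\cap H_0$, is bijective, and $(\mathcal A',\pi')$ and $(\mathcal A'',\pi'')$ belong to it, where $\pi'$ is the partition of $\mathcal A'$ into the non-empty sets $P\cap\mathcal A'$ for $P\in\pi$, and $\pi''$ is the partition of $\mathcal A''$ into the sets $\varrho(P)$ for $P\in\pi$, $P\neq\pi_1$. The arrangement $\mathcal A$ is inductively factored if $(\mathcal A,\pi)$ belongs to this class for some $\pi$. The arrangement $\mathcal A$ is hereditarily inductively factored (respectively,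 hereditarily inductively free) if $\mathcal A^X$ is inductively factored (respectively, inductively free) for every $X\in L(\mathcal A)$. Then: if $\mathcal A$ is hereditarily inductively factored, then $\mathcal A$ is hereditarily inductively free. -/

import Mathlib

open Module

universe u v

/-- A central hyperplane arrangement in the `K`-vector space `V`: a finite set of linear
hyperplanes, i.e. of maximal proper subspaces of `V`. -/
structure HypArrangement (K : Type u) [Field K] (V : Type v) [AddCommGroup V] [Module K V] where
  /-- the hyperplanes of the arrangement -/
  hyps : Finset (Submodule K V)
  isCoatom : ∀ H ∈ hyps, IsCoatom H

/-- If `X` is not contained in the hyperplane `H`, then `X ∩ H` is a hyperplane in `X`. -/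
theorem isCoatom_comap_subtype {K : Type u} [Field K] {V : Type v} [AddCommGroup V] [Module K V]
    {X H : Submodule K V} (hH : IsCoatom H) (hX : ¬ X ≤ H) :
    IsCoatom (H.comap X.subtype) := by
  refine ⟨fun h => hX (Submodule.comap_subtype_eq_top.mp h), fun W hW => ?_⟩
  obtain ⟨hle, hnot⟩ := SetLike.lt_iff_le_and_exists.mp hW
  obtain ⟨w, hwW, hwH⟩ := hnot
  have hsup : H ⊔ Submodule.span K {(w : V)} = ⊤ := by
    refine hH.2 _ (lt_of_le_of_ne le_sup_left fun h => hwH ?_)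
    have : (w : V) ∈ H ⊔ Submodule.span K {(w : V)} :=
      Submodule.mem_sup_right (Submodule.mem_span_singleton_self _)
    rw [← h] at this
    exact this
  refine eq_top_iff.mpr fun x _ => ?_
  have hx : (x : V) ∈ H ⊔ Submodule.span K {(w : V)} := by rw [hsup]; trivial
  obtain ⟨y, hy, z, hz, hyz⟩ := Submodule.mem_sup.mp hx
  obtain ⟨c, rfl⟩ := Submodule.mem_span_singleton.mp hz
  have h1 : x - c • w ∈ H.comap X.subtype := by
    have : ((x - c • w : X) : V) = y := by
      rw [Submodule.coe_sub, Submodule.coe_smul, ← hyz]; abel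
    simpa [Submodule.mem_comap, this] using hy
  have h2 : x = (x - c • w) + c • w := by abel
  rw [h2]
  exact W.add_mem (hle h1) (W.smul_mem c hwW)

namespace HypArrangement

section

variable {K : Type u} [Field K] {V : Type v} [AddCommGroup V] [Module K V]

/-- The empty arrangement in `V`. -/
def empty (K : Type u) [Field K] (V : Type v) [AddCommGroup V] [Module K V] :
    HypArrangement K V where
  hyps := ∅
  isCoatom := by simp

/-- The intersection lattice `L(A)`: all intersections of subsets of `A`; the intersection of
the empty subset is `V`. -/
def lattice (A : HypArrangement K V) : Set (Submodule K V) :=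
  {X | ∃ B : Finset (Submodule K V), B ⊆ A.hyps ∧ X = B.inf id}

open scoped Classical in
/-- The deletion `A' = A \ {H₀}`. -/
noncomputable def deletion (A : HypArrangement K V) (H₀ : Submodule K V) :
    HypArrangement K V where
  hyps := A.hyps.erase H₀
  isCoatom := fun H hH => A.isCoatom H (Finset.mem_of_mem_erase hH)

open scoped Classical in
/-- The restriction `A^X = {X ∩ H | H ∈ A, X ⊄ H}`, an arrangement in the vector space `X`;
the subspace `X ∩ H` of `X` is `H.comap X.subtype`. -/
noncomputable def restriction (A : HypArrangement K V) (X : Submodule K V) :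
    HypArrangement K X where
  hyps := (A.hyps.filter fun H => ¬ X ≤ H).image fun H => H.comap X.subtype
  isCoatom := by
    intro Y hY
    obtain ⟨H, hH, rfl⟩ := Finset.mem_image.mp hY
    obtain ⟨hHA, hXH⟩ := Finset.mem_filter.mp hH
    exact isCoatom_comap_subtype (A.isCoatom H hHA) hXH

/-! ### Derivations and exponents -/

/-- The coordinate ring `S = S(V*)`, the symmetric algebra of the dual space of `V`. -/
def CoordRing (K : Type u) [Field K] (V : Type v) [AddCommGroup V] [Module K V] : Type (max u v) :=
  SymmetricAlgebra K (Dual K V)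

noncomputable instance : CommRing (CoordRing K V) :=
  inferInstanceAs (CommRing (SymmetricAlgebra K (Dual K V)))

noncomputable instance : Algebra K (CoordRing K V) :=
  inferInstanceAs (Algebra K (SymmetricAlgebra K (Dual K V)))

/-- The embedding `V* → S(V*)` of the linear forms. -/
noncomputable def linForm (K : Type u) [Field K] (V : Type v) [AddCommGroup V] [Module K V] :
    Dual K V →ₗ[K] CoordRing K V :=
  SymmetricAlgebra.ι K (Dual K V)

/-- The module of `A`-derivations: the `S`-submodule `D(A)` of `Der_K(S)` of all `θ` such that
`α_H` divides `θ(α_H)` for every `H ∈ A`, where `α_H ∈ V*` is a linear form with kernel `H`. -/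
noncomputable def derivationModule (A : HypArrangement K V) :
    Submodule (CoordRing K V) (Derivation K (CoordRing K V) (CoordRing K V)) where
  carrier := {θ | ∀ H ∈ A.hyps, ∀ α : Dual K V, LinearMap.ker α = H →
    linForm K V α ∣ θ (linForm K V α)}
  add_mem' := fun ha hb H hH α hα => by
    rw [Derivation.add_apply]
    exact dvd_add (ha H hH α hα) (hb H hH α hα)
  zero_mem' := fun H _ α _ => by simp
  smul_mem' := fun c θ hθ H hH α hα => by
    rw [Derivation.smul_apply, smul_eq_mul]
    exact Dvd.dvd.mul_left (hθ H hH α hα) c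

/-- The homogeneous component `S_d`, spanned by all products of `d` linear forms. -/
noncomputable def homogComponent (K : Type u) [Field K] (V : Type v) [AddCommGroup V] [Module K V] (d : ℕ) :
    Submodule K (CoordRing K V) :=
  LinearMap.range (linForm K V) ^ d

/-- `θ` is homogeneous of polynomial degree `d`: it maps linear forms into `S_d`. -/
def IsHomogDerivation (θ : Derivation K (CoordRing K V) (CoordRing K V)) (d : ℕ) : Prop :=
  ∀ α : Dual K V, θ (linForm K V α) ∈ homogComponent K V d

/-- `A` is free with multiset of exponents `m`: the `S`-module `D(A)` has a basis
`θ₁, …, θ_ℓ` (`ℓ = dim V`) of homogeneous derivations, and `m` is the multiset of their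
polynomial degrees. -/
def IsFreeWithExponents (A : HypArrangement K V) (m : Multiset ℕ) : Prop :=
  ∃ (b : Basis (Fin (finrank K V)) (CoordRing K V) A.derivationModule)
    (d : Fin (finrank K V) → ℕ),
    (∀ i, IsHomogDerivation (b i : Derivation K (CoordRing K V) (CoordRing K V)) (d i)) ∧
      m = Finset.univ.val.map d

end

/-! ### Inductively free and inductively factored arrangements -/

/-- The smallest class of arrangements over `K` that contains all empty arrangements, and
contains `A` as soon as, for some `H₀ ∈ A`, it contains `A' = A \ {H₀}` and `A'' = A^{H₀}` and
`exp A'' ⊆ exp A'` as multisets. -/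
inductive IsInductivelyFree {K : Type u} [Field K] :
    ∀ {V : Type v} [AddCommGroup V] [Module K V] [FiniteDimensional K V],
      HypArrangement K V → Prop
  | empty {V : Type v} [AddCommGroup V] [Module K V] [FiniteDimensional K V] :
      IsInductivelyFree (HypArrangement.empty K V)
  | add {V : Type v} [AddCommGroup V] [Module K V] [FiniteDimensional K V]
      (A : HypArrangement K V) (H₀ : Submodule K V) (mem : H₀ ∈ A.hyps)
      (del : IsInductivelyFree (A.deletion H₀))
      (res : IsInductivelyFree (A.restriction H₀))
      (e' e'' : Multiset ℕ)
      (exp_del : (A.deletion H₀).IsFreeWithExponents e')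
      (exp_res : (A.restriction H₀).IsFreeWithExponents e'')
      (exp_le : e'' ≤ e') :
      IsInductivelyFree A

open scoped Classical in
/-- The smallest class of pairs `(A, π)` of an arrangement `A` over `K` and a partition `π` of
`A` into non-empty blocks that contains the empty arrangements with their only partition, and
contains `(A, π)` as soon as, for some block `P₁` of `π` and some `H₀ ∈ P₁`,
* the restriction map `A \ P₁ → A''`, `H ↦ H ∩ H₀`, is bijective,
* `(A', π')` is in the class, where `π'` consists of the non-empty sets `P ∩ A'`, `P ∈ π`,
* `(A'', π'')` is in the class, where `π''` consists of the images of the blocks `P ≠ P₁`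
  of `π` under the restriction map. -/
inductive IsInductiveFactorization {K : Type u} [Field K] :
    ∀ {V : Type v} [AddCommGroup V] [Module K V] [FiniteDimensional K V]
      (A : HypArrangement K V), Finpartition A.hyps → Prop
  | empty {V : Type v} [AddCommGroup V] [Module K V] [FiniteDimensional K V]
      (π : Finpartition (HypArrangement.empty K V).hyps) :
      IsInductiveFactorization (HypArrangement.empty K V) π
  | add {V : Type v} [AddCommGroup V] [Module K V] [FiniteDimensional K V]
      (A : HypArrangement K V) (π : Finpartition A.hyps)
      (P₁ : Finset (Submodule K V)) (block : P₁ ∈ π.parts)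
      (H₀ : Submodule K V) (mem : H₀ ∈ P₁)
      (bij : Set.BijOn (fun H : Submodule K V => H.comap H₀.subtype)
        (↑(A.hyps \ P₁) : Set (Submodule K V))
        (↑(A.restriction H₀).hyps : Set (Submodule K H₀)))
      (π' : Finpartition (A.deletion H₀).hyps)
      (parts_del : π'.parts = (π.parts.image fun P => P ∩ (A.deletion H₀).hyps).erase ∅)
      (del : IsInductiveFactorization (A.deletion H₀) π')
      (π'' : Finpartition (A.restriction H₀).hyps)
      (parts_res : π''.parts =
        (π.parts.erase P₁).image fun P => P.image fun H => H.comap H₀.subtype)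
      (res : IsInductiveFactorization (A.restriction H₀) π'') :
      IsInductiveFactorization A π

section

variable {K : Type u} [Field K] {V : Type v} [AddCommGroup V] [Module K V]
  [FiniteDimensional K V]

open scoped Classical in
/-- `A` is inductively factored if it has an inductive factorization. -/
def IsInductivelyFactored (A : HypArrangement K V) : Prop :=
  ∃ π : Finpartition A.hyps, IsInductiveFactorization A π

/-- `A^X` is inductively factored for every `X ∈ L(A)`. -/
def IsHereditarilyInductivelyFactored (A : HypArrangement K V) : Prop :=
  ∀ X ∈ A.lattice, (A.restriction X).IsInductivelyFactored

/-- `A^X` is inductively free for every `X ∈ L(A)`. -/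
def IsHereditarilyInductivelyFree (A : HypArrangement K V) : Prop :=
  ∀ X ∈ A.lattice, (A.restriction X).IsInductivelyFree

end

end HypArrangement

/-!
The heart of the matter is Terao's addition theorem. Let `H₀ ∈ A`, and let `ρ` be the restriction
of polynomial functions to `H₀`. Let `B` be homogeneous of degree `n` and divide `ρ(θ(α_{H₀}))` for
all `θ ∈ D(A')`. If `A''` is free with exponents `m` and `A'` with exponents `m` and `n`, then `A`
is free with exponents `m` and `n + 1`. Indeed, a homogeneous basis of `D(A')` has more members of
degree `≤ n` than one of `D(A'')`; were they all in `D(A)`, they would restrict to linearly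
independent elements of `D(A'')`. For one, `θ_k`, that is not in `D(A)`, `ρ(θ_k(α_{H₀}))` is `B` up
to a non-zero scalar. Subtracting multiples of `θ_k` puts all other members of the basis into
`D(A)`, and they form a basis of it together with `α_{H₀} θ_k`.

For a block `π₁ ∋ H₀` of an inductive factorization, take for `B` the product of the `ρ(α_H)`,
`H ∈ π₁ \ {H₀}`. Over `H ∩ H₀` there is also some `H₁ ∈ A \ π₁`, so that
`α_H = c α_{H₀} + d α_{H₁}` with `c ≠ 0`. If `θ(α_{H₁}) = g α_{H₁}`, then `α_H` divides
`θ(α_{H₀}) - g α_{H₀}`. So does the product of these `α_H` for all `H` that meet `H₀` in the same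
subspace, as they have the same `H₁`. By induction, the exponents are the block sizes and zeros.
-/

section LinearAlgebra

variable {R R' M N ι : Type*} [CommRing R] [CommRing R'] {σ : R →+* R'} {a : R}
  [AddCommGroup M] [Module R M] [AddCommGroup N]

theorem linearIndependent_comp_basis_of_semilinear [Module R' N] (hσ : Function.Surjective σ)
    (ha : σ a = 0) (f : M →ₛₗ[σ] N) (hf : ∀ x, f x = 0 → ∃ y, x = a • y) (b : Basis ι R M) :
    LinearIndependent R' (f ∘ b) := by
  rw [linearIndependent_iff']
  intro s g hg i hi
  choose c hc using fun j => hσ (g j)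
  obtain ⟨y, hy⟩ := hf (∑ j ∈ s, c j • b j) (by simpa [hc] using hg)
  have hci : c i = a * b.repr y i := by
    have := congr(b.repr $hy i)
    rw [map_sum, Finsupp.finsetSum_apply, Finset.sum_eq_single_of_mem i hi] at this
    · simpa using this
    · intro j _ hj
      simp [hj]
  rw [← hc, hci, map_mul, ha, zero_mul]

theorem transvection_injective [Module R N] [NoZeroDivisors R] {φ : Dual R N} {v : N}
    (h : 1 + φ v ≠ 0) : Function.Injective (LinearMap.transvection φ v) := by
  refine (injective_iff_map_eq_zero _).mpr fun x hx => ?_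
  rw [LinearMap.transvection.apply] at hx
  have hφx : (1 + φ v) * φ x = 0 := by
    have := congr(φ $hx)
    rw [map_add, map_smul, map_zero, smul_eq_mul] at this
    linear_combination this
  rwa [(mul_eq_zero.mp hφx).resolve_left h, zero_smul, add_zero] at hx

theorem mem_range_transvection_iff [Module R N] {φ : Dual R N} {v y : N} :
    y ∈ LinearMap.range (LinearMap.transvection φ v) ↔ 1 + φ v ∣ φ y := by
  constructor
  · rintro ⟨x, rfl⟩
    exact ⟨φ x, by rw [LinearMap.transvection.apply, map_add, map_smul, smul_eq_mul]; ring⟩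
  · rintro ⟨c, hc⟩
    refine ⟨y - c • v, ?_⟩
    rw [LinearMap.transvection.apply, map_sub, map_smul, hc, smul_eq_mul,
      show (1 + φ v) * c - c * φ v = c by ring, sub_add_cancel]

/-- The new basis is the image of `b` under the transvection `x ↦ x + φ x • b k`, where `φ` is
`-g` on the `b j`, `j ≠ k`, and `a - 1` on `b k`; this `φ` satisfies `f x = σ (-φ x) * f (b k)`
for all `x`. -/
theorem exists_basis_of_exact_semilinear [Module R N] [IsDomain R] [NoZeroDivisors R'] (ha : a ≠ 0)
    (hσ : ∀ x, σ x = 0 ↔ a ∣ x) {i : N →ₗ[R] M} (hi : Function.Injective i) {f : M →ₛₗ[σ] R'}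
    (hif : Function.Exact i f) (b : Basis ι R M) {k : ι} (hk : f (b k) ≠ 0) {g : ι → R}
    (hg : ∀ j, f (b j) = σ (g j) * f (b k)) :
    ∃ b' : Basis ι R N, i (b' k) = a • b k ∧ ∀ j ≠ k, i (b' j) = b j - g j • b k := by
  classical
  let φ : Dual R M := b.constr R (Function.update (-g) k (a - 1))
  have hφk : φ (b k) = a - 1 := by simp [φ]
  have hφj : ∀ j ≠ k, φ (b j) = -g j := fun j hj => by simp [φ, hj]
  have hfφ : f =
      (LinearMap.toSpanSingleton R' R' (f (b k))).comp (σ.toSemilinearMap.comp (-φ)) := by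
    refine b.ext fun j => ?_
    rcases eq_or_ne j k with rfl | hj
    · simp [hφk, (hσ a).mpr dvd_rfl]
    · simp [hφj j hj, hg j]
  have h1φ : 1 + φ (b k) = a := by rw [hφk, add_sub_cancel]
  let T : M →ₗ[R] M := LinearMap.transvection φ (b k)
  have hT : ∀ x, T x = x + φ x • b k := LinearMap.transvection.apply φ (b k)
  have range_T : LinearMap.range T = LinearMap.range i := by
    ext y
    rw [mem_range_transvection_iff, h1φ, ← hσ, LinearMap.mem_range, ← Set.mem_range, ← hif y, hfφ]
    simp [hk]
  let e : M ≃ₗ[R] N := (LinearEquiv.ofInjective T (transvection_injective (by rwa [h1φ]))).trans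
    ((LinearEquiv.ofEq _ _ range_T).trans (LinearEquiv.ofInjective i hi).symm)
  have hie : ∀ x, i (e x) = T x := fun x => by
    rw [← LinearEquiv.ofInjective_apply (h := hi)]
    simp [e]
  refine ⟨b.map e, ?_, fun j hj => ?_⟩
  · rw [Basis.map_apply, hie, hT, hφk, sub_smul, one_smul, add_sub_cancel]
  · rw [Basis.map_apply, hie, hT, hφj j hj, neg_smul, sub_eq_add_neg]

theorem exists_derivation_eq_smul_of_dvd {A : Type*} [CommRing A] [IsDomain A] [Algebra R A] {a : A}
    (ha : a ≠ 0) {θ : Derivation R A A} (h : ∀ x, a ∣ θ x) : ∃ η : Derivation R A A, θ = a • η := by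
  choose f hf using h
  refine ⟨Derivation.mk' { toFun := f, map_add' := ?_, map_smul' := ?_ } ?_, Derivation.ext hf⟩
  · intro x y
    apply mul_left_cancel₀ ha
    rw [mul_add, ← hf, ← hf, ← hf, map_add]
  · intro c x
    apply mul_left_cancel₀ ha
    rw [RingHom.id_apply, mul_smul_comm, ← hf, ← hf, Derivation.map_smul]
  · intro x y
    apply mul_left_cancel₀ ha
    change a * f (x * y) = a * (x • f y + y • f x)
    rw [mul_add, mul_smul_comm, mul_smul_comm, ← hf, ← hf, ← hf, Derivation.leibniz]

theorem exists_eq_smul_add_smul_of_ker_inf_ker_le {k V : Type*} [Field k] [AddCommGroup V]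
    [Module k V] {α β γ : Dual k V}
    (h : LinearMap.ker α ⊓ LinearMap.ker β ≤ LinearMap.ker γ) :
    ∃ c d : k, γ = c • α + d • β := by
  have hγ : γ ∈ Submodule.span k (Set.range fun i : Bool => cond i α β) :=
    mem_span_of_iInf_ker_le_ker (by rwa [iInf_bool_eq])
  rw [Bool.range_eq, Submodule.mem_span_pair] at hγ
  obtain ⟨d, c, hγ⟩ := hγ
  exact ⟨c, d, by rw [← hγ, add_comm]; rfl⟩

end LinearAlgebra

section Multiset

theorem map_update_eq_cons_of_map_eq_cons {ι α : Type*} [Fintype ι] [DecidableEq ι] {d : ι → α}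
    {k : ι} {m : Multiset α} (h : Finset.univ.val.map d = d k ::ₘ m) (x : α) :
    Finset.univ.val.map (Function.update d k x) = x ::ₘ m := by
  rw [← Finset.insert_erase (Finset.mem_univ k),
    Finset.insert_val_of_notMem (Finset.notMem_erase k _), Multiset.map_cons] at h ⊢
  rw [Function.update_self, ← (Multiset.cons_inj_right _).mp h]
  congr 1
  exact Multiset.map_congr rfl fun j hj => Function.update_of_ne (Finset.ne_of_mem_erase hj) _ _

end Multiset

section BlockSizes

/-- The multiset of the sizes of the members of `s`, padded with zeros to length `r`. It is longer
than `r` if `s` has more than `r` members. -/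
def blockSizes {γ : Type*} (s : Finset (Finset γ)) (r : ℕ) : Multiset ℕ :=
  s.val.map Finset.card + Multiset.replicate (r - s.card) 0

variable {γ δ : Type*}

theorem card_le_of_card_blockSizes {s : Finset (Finset γ)} {r : ℕ} (h : (blockSizes s r).card = r) :
    s.card ≤ r := by
  simp only [blockSizes, Multiset.card_add, Multiset.card_map, Multiset.card_replicate,
    Finset.card_val] at h
  omega

theorem blockSizes_empty (r : ℕ) :
    blockSizes (∅ : Finset (Finset γ)) r = Multiset.replicate r 0 := by
  simp [blockSizes]

theorem blockSizes_image_image [DecidableEq δ] {f : γ → δ} {t : Finset γ} (hf : Set.InjOn f t)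
    {s : Finset (Finset γ)} (hs : ∀ P ∈ s, P ⊆ t) (r : ℕ) :
    blockSizes (s.image (Finset.image f)) r = blockSizes s r := by
  have hinj : Set.InjOn (Finset.image f) (s : Set (Finset γ)) := fun P hP Q hQ hPQ => by
    have himage : f '' P = f '' Q := by simpa using congr((($hPQ : Finset δ) : Set δ))
    exact Finset.coe_injective <| (hf.image_eq_image_iff (Finset.coe_subset.mpr (hs P hP))
      (Finset.coe_subset.mpr (hs Q hQ))).mp himage
  rw [blockSizes, blockSizes, Finset.image_val_of_injOn hinj, Finset.card_image_of_injOn hinj,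
    Multiset.map_map]
  congr 1
  exact Multiset.map_congr rfl fun P hP =>
    Finset.card_image_of_injOn (hf.mono (Finset.coe_subset.mpr (hs P hP)))

variable [DecidableEq γ]

theorem blockSizes_insert_erase_empty {s : Finset (Finset γ)} {Q : Finset γ} {r : ℕ} (hs : ∅ ∉ s)
    (hQ : Q ∉ s) (hr : s.card ≤ r) :
    blockSizes ((insert Q s).erase ∅) (r + 1) = Q.card ::ₘ blockSizes s r := by
  rcases Q.eq_empty_or_nonempty with rfl | hQne
  · rw [Finset.erase_insert hs, blockSizes, blockSizes, Finset.card_empty, Nat.sub_add_comm hr,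
      Multiset.replicate_succ, Multiset.add_cons]
  · have hempty : ∅ ∉ insert Q s := by simp [hs, hQne.ne_empty.symm]
    rw [Finset.erase_eq_of_notMem hempty, blockSizes, blockSizes, Finset.insert_val_of_notMem hQ,
      Finset.card_insert_of_notMem hQ, Multiset.map_cons, Multiset.cons_add,
      Nat.add_sub_add_right]

variable {s P : Finset γ} {π : Finpartition s} {x : γ}

theorem erase_notMem_erase_parts (hP : P ∈ π.parts) : P.erase x ∉ π.parts.erase P := fun hmem => by
  obtain ⟨hne, hparts⟩ := Finset.mem_erase.mp hmem
  have hdisj : Disjoint (P.erase x) P := π.disjoint hparts hP hne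
  exact π.ne_bot hparts (disjoint_self.mp (hdisj.mono_right (P.erase_subset x)))

theorem image_inter_erase_parts (hP : P ∈ π.parts) (hx : x ∈ P) :
    π.parts.image (fun Q => Q ∩ s.erase x) = insert (P.erase x) (π.parts.erase P) := by
  have hinterP : P ∩ s.erase x = P.erase x := by
    rw [Finset.inter_erase, Finset.inter_eq_left.mpr (π.le hP)]
  have hinter : ∀ Q ∈ π.parts.erase P, Q ∩ s.erase x = Q := fun Q hQ => by
    obtain ⟨hne, hQ⟩ := Finset.mem_erase.mp hQ
    have hxQ : x ∉ Q := fun hxQ => Finset.disjoint_left.mp (π.disjoint hQ hP hne) hxQ hx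
    rw [Finset.inter_erase, Finset.inter_eq_left.mpr (π.le hQ), Finset.erase_eq_of_notMem hxQ]
  conv_lhs => rw [← Finset.insert_erase hP]
  rw [Finset.image_insert, hinterP, Finset.image_congr (g := id) hinter, Finset.image_id]

theorem blockSizes_parts_succ {r : ℕ} (hP : P ∈ π.parts) (hr : (π.parts.erase P).card ≤ r) :
    blockSizes π.parts (r + 1) = P.card ::ₘ blockSizes (π.parts.erase P) r := by
  have hempty : ∅ ∉ π.parts := π.bot_notMem
  rw [← blockSizes_insert_erase_empty (fun h => hempty (Finset.mem_of_mem_erase h))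
    (Finset.notMem_erase P _) hr, Finset.insert_erase hP, Finset.erase_eq_of_notMem hempty]

theorem blockSizes_image_inter_erase_parts {r : ℕ} (hP : P ∈ π.parts) (hx : x ∈ P)
    (hr : (π.parts.erase P).card ≤ r) :
    blockSizes ((π.parts.image fun Q => Q ∩ s.erase x).erase ∅) (r + 1) =
      (P.erase x).card ::ₘ blockSizes (π.parts.erase P) r := by
  rw [image_inter_erase_parts hP hx]
  exact blockSizes_insert_erase_empty (fun h => π.bot_notMem (Finset.mem_of_mem_erase h))
    (erase_notMem_erase_parts hP) hr

end BlockSizes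

namespace HypArrangement

variable {K : Type u} [Field K] {V : Type v} [AddCommGroup V] [Module K V]

section CoordRing

instance : IsDomain (CoordRing K V) :=
  inferInstanceAs (IsDomain (SymmetricAlgebra K (Dual K V)))

/-- The identification of `S(V*)` with the polynomial ring in the members of a basis of `V*`. -/
noncomputable def coordEquiv {ι : Type*} (b : Basis ι K (Dual K V)) :
    CoordRing K V ≃ₐ[K] MvPolynomial ι K :=
  SymmetricAlgebra.equivMvPolynomial b

@[simp]
theorem coordEquiv_linForm {ι : Type*} (b : Basis ι K (Dual K V)) (i : ι) :
    coordEquiv b (linForm K V (b i)) = MvPolynomial.X i :=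
  SymmetricAlgebra.equivMvPolynomial_ι_apply b i

instance : UniqueFactorizationMonoid (CoordRing K V) :=
  (coordEquiv (Basis.ofVectorSpace K (Dual K V))).symm.toMulEquiv.uniqueFactorizationMonoid
    inferInstance

variable {B : Type*} [CommRing B] [Algebra K B]

/-- The algebra homomorphism on `S(V*)` with prescribed values on the linear forms. -/
noncomputable def coordLift (f : Dual K V →ₗ[K] B) : CoordRing K V →ₐ[K] B :=
  SymmetricAlgebra.lift f

@[simp]
theorem coordLift_linForm (f : Dual K V →ₗ[K] B) (α : Dual K V) :
    coordLift f (linForm K V α) = f α :=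
  SymmetricAlgebra.lift_ι_apply f α

theorem coordRing_induction {motive : CoordRing K V → Prop}
    (algebraMap : ∀ r, motive (algebraMap K (CoordRing K V) r))
    (linForm : ∀ α, motive (linForm K V α))
    (mul : ∀ a b, motive a → motive b → motive (a * b))
    (add : ∀ a b, motive a → motive b → motive (a + b)) (a : CoordRing K V) : motive a :=
  SymmetricAlgebra.induction (R := K) (M := Dual K V) (motive := motive)
    algebraMap linForm mul add a

theorem coordRing_algHom_ext {f g : CoordRing K V →ₐ[K] B}
    (h : ∀ α, f (linForm K V α) = g (linForm K V α)) : f = g :=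
  SymmetricAlgebra.algHom_ext (R := K) (M := Dual K V) (LinearMap.ext h)

theorem linForm_injective : Function.Injective (linForm K V) := by
  refine (injective_iff_map_eq_zero _).mpr fun α hα => LinearMap.ext fun v => ?_
  simpa using congr(coordLift (Dual.eval K V v) $hα)

end CoordRing

section Grading

theorem linForm_mem_homogComponent (α : Dual K V) : linForm K V α ∈ homogComponent K V 1 := by
  simp [homogComponent]

theorem mul_mem_homogComponent {x y : CoordRing K V} {m n : ℕ} (hx : x ∈ homogComponent K V m)
    (hy : y ∈ homogComponent K V n) : x * y ∈ homogComponent K V (m + n) := by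
  rw [homogComponent, pow_add]
  exact Submodule.mul_mem_mul hx hy

theorem prod_linForm_mem_homogComponent {ι : Type*} (s : Finset ι) (f : ι → Dual K V) :
    ∏ i ∈ s, linForm K V (f i) ∈ homogComponent K V s.card := by
  classical
  induction s using Finset.induction_on with
  | empty => simp [homogComponent]
  | insert a s ha ih =>
    rw [Finset.prod_insert ha, Finset.card_insert_of_notMem ha, add_comm]
    exact mul_mem_homogComponent (linForm_mem_homogComponent _) ih

theorem mem_homogComponent_zero {x : CoordRing K V} :
    x ∈ homogComponent K V 0 ↔ ∃ c : K, algebraMap K (CoordRing K V) c = x := by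
  rw [homogComponent, pow_zero, Submodule.mem_one]

/-- The homomorphism `S(V*) → S(V*)[T]` that sends `α ∈ V*` to `α T`; its coefficients are the
homogeneous parts. -/
noncomputable def gradingHom (K : Type u) [Field K] (V : Type v) [AddCommGroup V] [Module K V] :
    CoordRing K V →ₐ[K] Polynomial (CoordRing K V) :=
  coordLift ((Polynomial.monomial 1).restrictScalars K ∘ₗ linForm K V)

theorem gradingHom_linForm (α : Dual K V) :
    gradingHom K V (linForm K V α) = Polynomial.monomial 1 (linForm K V α) := by
  simp [gradingHom]

theorem gradingHom_of_mem {n : ℕ} {x : CoordRing K V} (hx : x ∈ homogComponent K V n) :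
    gradingHom K V x = Polynomial.monomial n x := by
  rw [homogComponent] at hx
  induction hx using Submodule.pow_induction_on_left' with
  | algebraMap r => simp [AlgHom.commutes]
  | add x y i _ _ ihx ihy => simp [ihx, ihy]
  | mem_mul m hm i x _ ih =>
    obtain ⟨α, rfl⟩ := hm
    rw [map_mul, ih, gradingHom_linForm, Polynomial.monomial_mul_monomial, add_comm]

/-- The homogeneous part of degree `n`. -/
noncomputable def homogPart (n : ℕ) : CoordRing K V →ₗ[K] CoordRing K V :=
  (Polynomial.lcoeff (CoordRing K V) n).restrictScalars K ∘ₗ (gradingHom K V).toLinearMap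

theorem homogPart_apply (n : ℕ) (x : CoordRing K V) :
    homogPart n x = (gradingHom K V x).coeff n := rfl

theorem homogPart_mem (n : ℕ) (x : CoordRing K V) : homogPart n x ∈ homogComponent K V n := by
  rw [homogPart_apply]
  induction x using coordRing_induction generalizing n with
  | algebraMap r =>
    rw [AlgHom.commutes, Polynomial.algebraMap_apply, Polynomial.coeff_C]
    split_ifs with h
    · subst h
      exact mem_homogComponent_zero.mpr ⟨r, rfl⟩
    · exact Submodule.zero_mem _
  | linForm α =>
    rw [gradingHom_linForm, Polynomial.coeff_monomial]
    split_ifs with h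
    · subst h
      exact linForm_mem_homogComponent α
    · exact Submodule.zero_mem _
  | mul a b ha hb =>
    rw [map_mul, Polynomial.coeff_mul]
    refine Submodule.sum_mem _ fun p hp => ?_
    rw [← Finset.HasAntidiagonal.mem_antidiagonal.mp hp]
    exact mul_mem_homogComponent (ha _) (hb _)
  | add a b ha hb =>
    rw [map_add, Polynomial.coeff_add]
    exact Submodule.add_mem _ (ha n) (hb n)

theorem homogPart_of_mem {n : ℕ} {x : CoordRing K V} (hx : x ∈ homogComponent K V n) :
    homogPart n x = x := by
  simp [homogPart_apply, gradingHom_of_mem hx]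

theorem homogPart_mul_of_mem {n d : ℕ} (x : CoordRing K V) {y : CoordRing K V}
    (hy : y ∈ homogComponent K V d) :
    homogPart n (x * y) = if d ≤ n then homogPart (n - d) x * y else 0 := by
  rw [homogPart_apply, map_mul, gradingHom_of_mem hy, ← Polynomial.C_mul_X_pow_eq_monomial,
    ← mul_assoc, Polynomial.coeff_mul_X_pow', Polynomial.coeff_mul_C, homogPart_apply]

theorem exists_homogComponent_mul_eq_of_dvd {n d : ℕ} {x y : CoordRing K V}
    (hx : x ∈ homogComponent K V n) (hy : y ∈ homogComponent K V d) (hxy : x ∣ y) (hy0 : y ≠ 0) :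
    ∃ e, e + n = d ∧ ∃ z ∈ homogComponent K V e, z * x = y := by
  obtain ⟨z, rfl⟩ := hxy
  have hpart := homogPart_mul_of_mem (n := d) z hx
  rw [mul_comm z, homogPart_of_mem hy] at hpart
  split_ifs at hpart with hnd
  · exact ⟨d - n, Nat.sub_add_cancel hnd, homogPart (d - n) z, homogPart_mem _ _, hpart.symm⟩
  · exact absurd hpart hy0

end Grading

section Pullback

variable {W : Type*} [AddCommGroup W] [Module K W]

/-- The homomorphism `S(W*) → S(V*)` of composition with `f : V → W`. -/
noncomputable def pullback (f : V →ₗ[K] W) : CoordRing K W →ₐ[K] CoordRing K V :=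
  coordLift (linForm K V ∘ₗ f.dualMap)

@[simp]
theorem pullback_linForm (f : V →ₗ[K] W) (α : Dual K W) :
    pullback f (linForm K W α) = linForm K V (α ∘ₗ f) := by
  simp [pullback, LinearMap.dualMap_apply']

theorem pullback_id (x : CoordRing K V) : pullback LinearMap.id x = x := by
  have : pullback (LinearMap.id : V →ₗ[K] V) = AlgHom.id K _ :=
    coordRing_algHom_ext fun α => by simp
  rw [this, AlgHom.id_apply]

theorem pullback_comp {U : Type*} [AddCommGroup U] [Module K U] (f : U →ₗ[K] V) (g : V →ₗ[K] W)
    (x : CoordRing K W) : pullback (g ∘ₗ f) x = pullback f (pullback g x) := by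
  have : pullback (g ∘ₗ f) = (pullback f).comp (pullback g) :=
    coordRing_algHom_ext fun α => by simp [LinearMap.comp_assoc]
  rw [this, AlgHom.comp_apply]

theorem pullback_mem_homogComponent (f : V →ₗ[K] W) {n : ℕ} {x : CoordRing K W}
    (hx : x ∈ homogComponent K W n) : pullback f x ∈ homogComponent K V n := by
  have h : (homogComponent K W n).map (pullback f).toLinearMap ≤ homogComponent K V n := by
    rw [homogComponent, Submodule.map_pow, homogComponent]
    refine pow_le_pow_left' ?_ n
    rintro _ ⟨_, ⟨α, rfl⟩, rfl⟩
    exact ⟨_, (pullback_linForm f α).symm⟩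
  exact h ⟨x, hx, rfl⟩

/-- The restriction homomorphism `S(V*) → S(X*)`. -/
noncomputable abbrev resHom (X : Submodule K V) : CoordRing K V →ₐ[K] CoordRing K X :=
  pullback X.subtype

theorem resHom_pullback {X : Submodule K V} {p : V →ₗ[K] X} (hp : p ∘ₗ X.subtype = LinearMap.id)
    (x : CoordRing K X) : resHom X (pullback p x) = x := by
  rw [← pullback_comp, hp, pullback_id]

theorem exists_homogComponent_resHom_eq {X : Submodule K V} {n : ℕ} {y : CoordRing K X}
    (hy : y ∈ homogComponent K X n) : ∃ x ∈ homogComponent K V n, resHom X x = y := by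
  obtain ⟨p, hp⟩ := X.subtype.exists_leftInverse_of_injective X.ker_subtype
  exact ⟨pullback p y, pullback_mem_homogComponent p hy, resHom_pullback hp y⟩

theorem resHom_surjective (X : Submodule K V) : Function.Surjective (resHom X) := by
  obtain ⟨p, hp⟩ := X.subtype.exists_leftInverse_of_injective X.ker_subtype
  exact fun y => ⟨pullback p y, resHom_pullback hp y⟩

theorem linForm_dvd_sub_pullback (α : Dual K V) (v : V) (x : CoordRing K V) :
    linForm K V α ∣ x - pullback (LinearMap.id - α.smulRight v) x := by
  let q := Ideal.Quotient.mkₐ K (Ideal.span {linForm K V α})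
  have h : q.comp (pullback (LinearMap.id - α.smulRight v)) = q :=
    coordRing_algHom_ext fun β => by
      rw [AlgHom.comp_apply, eq_comm, ← sub_eq_zero, ← map_sub, Ideal.Quotient.mkₐ_eq_mk,
        Ideal.Quotient.eq_zero_iff_mem, Ideal.mem_span_singleton, pullback_linForm, ← map_sub]
      have : β - β ∘ₗ (LinearMap.id - α.smulRight v) = β v • α := by
        ext w
        simp [mul_comm]
      rw [this, map_smul]
      exact dvd_smul_of_dvd _ dvd_rfl
  rw [← Ideal.mem_span_singleton, ← Ideal.Quotient.eq_zero_iff_mem, map_sub, sub_eq_zero]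
  exact congr($h x).symm

theorem resHom_eq_zero_iff {H : Submodule K V} {α : Dual K V} (hα : LinearMap.ker α = H)
    {x : CoordRing K V} : resHom H x = 0 ↔ linForm K V α ∣ x := by
  subst hα
  constructor
  · intro hx
    obtain ⟨v, hv⟩ : ∃ v, ∀ w, α (w - α w • v) = 0 := by
      rcases eq_or_ne α 0 with rfl | hα
      · exact ⟨0, fun _ => rfl⟩
      · exact (LinearMap.surjective hα 1).imp fun v hv w => by simp [hv]
    let p : V →ₗ[K] LinearMap.ker α := (LinearMap.id - α.smulRight v).codRestrict _ hv
    have hp : (LinearMap.ker α).subtype ∘ₗ p = LinearMap.id - α.smulRight v := rfl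
    have hdvd := linForm_dvd_sub_pullback α v x
    rwa [← hp, pullback_comp, hx, map_zero, sub_zero] at hdvd
  · rintro ⟨y, rfl⟩
    rw [map_mul, pullback_linForm, LinearMap.comp_ker_subtype, map_zero, zero_mul]

end Pullback

section DefiningForm

/-- A linear form with kernel `H`, chosen arbitrarily; it has no meaning if there is no such form,
that is if `H` is neither a hyperplane nor the whole space. -/
noncomputable def definingForm (H : Submodule K V) : Dual K V :=
  Classical.epsilon fun α => LinearMap.ker α = H

/-- The element `α_H` of `S(V*)` for a hyperplane `H`. -/
noncomputable abbrev definingPoly (H : Submodule K V) : CoordRing K V :=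
  linForm K V (definingForm H)

variable {H H' : Submodule K V}

theorem ker_definingForm (hH : IsCoatom H) : LinearMap.ker (definingForm H) = H := by
  obtain ⟨α, hα, hle⟩ := H.exists_le_ker_of_lt_top hH.lt_top
  exact Classical.epsilon_spec (p := fun β : Dual K V => LinearMap.ker β = H)
    ⟨α, (hH.le_iff.mp hle).resolve_left fun h => hα (LinearMap.ker_eq_top.mp h)⟩

theorem linForm_prime {α : Dual K V} (hα : α ≠ 0) : Prime (linForm K V α) := by
  refine ⟨(map_ne_zero_iff _ linForm_injective).mpr hα, fun hu => ?_, fun a b => ?_⟩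
  · have hu' := hu.map (resHom (LinearMap.ker α))
    rw [(resHom_eq_zero_iff rfl).mpr dvd_rfl] at hu'
    exact not_isUnit_zero hu'
  · simp only [← resHom_eq_zero_iff rfl, map_mul, mul_eq_zero, imp_self]

theorem linForm_dvd_linForm_iff {α β : Dual K V} :
    linForm K V α ∣ linForm K V β ↔ LinearMap.ker α ≤ LinearMap.ker β := by
  rw [← resHom_eq_zero_iff rfl, pullback_linForm, map_eq_zero_iff _ linForm_injective]
  exact ⟨fun h x hx => congr($h ⟨x, hx⟩), fun h => LinearMap.ext fun x => h x.2⟩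

theorem definingForm_ne_zero (hH : IsCoatom H) : definingForm H ≠ 0 := fun h =>
  hH.1 (by rw [← ker_definingForm hH, h, LinearMap.ker_zero])

theorem definingPoly_ne_zero (hH : IsCoatom H) : definingPoly H ≠ 0 :=
  (linForm_prime (definingForm_ne_zero hH)).ne_zero

theorem not_le_of_isCoatom_of_ne (hH : IsCoatom H) (hH' : IsCoatom H') (hne : H ≠ H') : ¬ H ≤ H' :=
  fun hle => hne ((hH.le_iff_eq hH'.1).mp hle).symm

theorem isRelPrime_linForm {α β : Dual K V} (hα : IsCoatom (LinearMap.ker α))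
    (hβ : IsCoatom (LinearMap.ker β)) (hne : LinearMap.ker α ≠ LinearMap.ker β) :
    IsRelPrime (linForm K V α) (linForm K V β) := by
  have hα0 : α ≠ 0 := fun h => hα.1 (LinearMap.ker_eq_top.mpr h)
  rw [(linForm_prime hα0).irreducible.isRelPrime_iff_not_dvd, linForm_dvd_linForm_iff]
  exact not_le_of_isCoatom_of_ne hα hβ hne

end DefiningForm

section DerivationModule

/-- The module `Der_K(S)` of derivations of the coordinate ring. -/
abbrev Der (K : Type u) [Field K] (V : Type v) [AddCommGroup V] [Module K V] : Type (max u v) :=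
  Derivation K (CoordRing K V) (CoordRing K V)

theorem der_ext {θ η : Der K V} (h : ∀ α, θ (linForm K V α) = η (linForm K V α)) : θ = η := by
  ext x
  induction x using coordRing_induction with
  | algebraMap r => simp
  | linForm α => exact h α
  | mul a b ha hb => simp [ha, hb]
  | add a b ha hb => simp [ha, hb]

variable {A : HypArrangement K V} {H₀ : Submodule K V} {θ : Der K V}

theorem mem_deletion_hyps {H : Submodule K V} :
    H ∈ (A.deletion H₀).hyps ↔ H ≠ H₀ ∧ H ∈ A.hyps := by
  simp [deletion]

theorem notMem_deletion_hyps : H₀ ∉ (A.deletion H₀).hyps := fun h => (mem_deletion_hyps.mp h).1 rfl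

theorem mem_restriction_hyps {X : Submodule K V} {Y : Submodule K X} :
    Y ∈ (A.restriction X).hyps ↔ ∃ H ∈ A.hyps, ¬ X ≤ H ∧ H.comap X.subtype = Y := by
  simp [restriction, and_assoc]

theorem linForm_dvd_der_of_ker_le {α β : Dual K V} (h : LinearMap.ker α ≤ LinearMap.ker β)
    (hα : linForm K V α ∣ θ (linForm K V α)) : linForm K V β ∣ θ (linForm K V β) := by
  obtain ⟨c, d, hβ⟩ := exists_eq_smul_add_smul_of_ker_inf_ker_le (β := 0) (inf_le_left.trans h)
  obtain ⟨g, hg⟩ := hα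
  exact ⟨g, by rw [hβ, smul_zero, add_zero, map_smul, Derivation.map_smul, hg, smul_mul_assoc]⟩

theorem mem_derivationModule_iff :
    θ ∈ A.derivationModule ↔ ∀ H ∈ A.hyps, definingPoly H ∣ θ (definingPoly H) := by
  refine ⟨fun hθ H hH => hθ H hH _ (ker_definingForm (A.isCoatom H hH)), fun hθ H hH α hα => ?_⟩
  refine linForm_dvd_der_of_ker_le ?_ (hθ H hH)
  rw [ker_definingForm (A.isCoatom H hH), hα]

theorem mem_derivationModule_iff_deletion (hH₀ : H₀ ∈ A.hyps) :
    θ ∈ A.derivationModule ↔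
      θ ∈ (A.deletion H₀).derivationModule ∧ resHom H₀ (θ (definingPoly H₀)) = 0 := by
  simp only [mem_derivationModule_iff, mem_deletion_hyps,
    resHom_eq_zero_iff (ker_definingForm (A.isCoatom H₀ hH₀))]
  refine ⟨fun h => ⟨fun H hH => h H hH.2, h H₀ hH₀⟩, fun h H hH => ?_⟩
  rcases eq_or_ne H H₀ with rfl | hne
  · exact h.2
  · exact h.1 H ⟨hne, hH⟩

theorem mem_derivationModule_of_definingPoly_smul_mem (hH₀ : IsCoatom H₀) (hA : H₀ ∉ A.hyps)
    (h : definingPoly H₀ • θ ∈ A.derivationModule) : θ ∈ A.derivationModule := by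
  rw [mem_derivationModule_iff] at h ⊢
  intro H hH
  have hHc := A.isCoatom H hH
  have hprime := linForm_prime (definingForm_ne_zero hHc)
  refine (hprime.dvd_mul.mp (h H hH)).resolve_left fun hdvd => ?_
  rw [linForm_dvd_linForm_iff, ker_definingForm hHc, ker_definingForm hH₀] at hdvd
  exact not_le_of_isCoatom_of_ne hHc hH₀ (ne_of_mem_of_not_mem hH hA) hdvd

end DerivationModule

section Restriction

variable {A : HypArrangement K V} {X H₀ : Submodule K V} {θ : Der K V} {η : Der K X}

theorem isHomogDerivation_of_comp_resHom (h : ∀ x, η (resHom X x) = resHom X (θ x)) {d : ℕ}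
    (hθ : IsHomogDerivation θ d) : IsHomogDerivation η d := fun β => by
  obtain ⟨p, hp⟩ := X.subtype.exists_leftInverse_of_injective X.ker_subtype
  rw [← resHom_pullback hp (linForm K X β), h, pullback_linForm]
  exact pullback_mem_homogComponent _ (hθ _)

theorem mem_derivationModule_restriction_of_comp_resHom (hθ : θ ∈ A.derivationModule)
    (h : ∀ x, η (resHom X x) = resHom X (θ x)) : η ∈ (A.restriction X).derivationModule := by
  intro Y hY β hβ
  obtain ⟨H, hH, -, rfl⟩ := mem_restriction_hyps.mp hY
  refine linForm_dvd_der_of_ker_le (α := definingForm H ∘ₗ X.subtype) ?_ ?_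
  · rw [LinearMap.ker_comp, ker_definingForm (A.isCoatom H hH), hβ]
  · rw [← pullback_linForm, h]
    exact map_dvd _ (mem_derivationModule_iff.mp hθ H hH)

theorem resHom_der_eq_zero (hθ : θ ∈ A.derivationModule) (hH₀ : H₀ ∈ A.hyps) {x : CoordRing K V}
    (hx : resHom H₀ x = 0) : resHom H₀ (θ x) = 0 := by
  have hker := ker_definingForm (A.isCoatom H₀ hH₀)
  have hθ₀ := ((mem_derivationModule_iff_deletion hH₀).mp hθ).2
  obtain ⟨y, rfl⟩ := (resHom_eq_zero_iff hker).mp hx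
  rw [Derivation.leibniz, map_add, smul_eq_mul, smul_eq_mul, map_mul, map_mul, hθ₀, mul_zero,
    (resHom_eq_zero_iff hker).mpr dvd_rfl, zero_mul, add_zero]

theorem exists_der_comp_resHom_eq (hθ : θ ∈ A.derivationModule) (hH₀ : H₀ ∈ A.hyps) :
    ∃ η : Der K H₀, ∀ x, η (resHom H₀ x) = resHom H₀ (θ x) := by
  obtain ⟨p, hp⟩ := H₀.subtype.exists_leftInverse_of_injective H₀.ker_subtype
  refine ⟨Derivation.mk'
    ((resHom H₀).toLinearMap ∘ₗ θ.toLinearMap ∘ₗ (pullback p).toLinearMap) ?_, fun x => ?_⟩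
  · intro x y
    simp [resHom_pullback hp]
  · have hker : resHom H₀ (pullback p (resHom H₀ x) - x) = 0 := by
      rw [map_sub, resHom_pullback hp, sub_self]
    have h := resHom_der_eq_zero hθ hH₀ hker
    rwa [map_sub, map_sub, sub_eq_zero] at h

/-- The restriction to `X` of the values of a derivation. It is semilinear, and defined on all of
`Der_K(S)` because it does not ask for a derivation of the coordinate ring of `X`. -/
noncomputable def resDer (X : Submodule K V) :
    Der K V →ₛₗ[(resHom X : CoordRing K V →+* CoordRing K X)] CoordRing K V → CoordRing K X where
  toFun θ x := resHom X (θ x)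
  map_add' θ η := by ext; simp
  map_smul' c θ := by ext; simp

theorem linearIndependent_resDer_comp_basis (hH₀ : IsCoatom H₀) (hA : H₀ ∉ A.hyps) {ι : Type*}
    (b : Basis ι (CoordRing K V) A.derivationModule) :
    LinearIndependent (CoordRing K H₀) fun i => resDer H₀ (b i : Der K V) := by
  have hker := ker_definingForm hH₀
  refine linearIndependent_comp_basis_of_semilinear (a := definingPoly H₀) (resHom_surjective H₀)
    ((resHom_eq_zero_iff hker).mpr dvd_rfl)
    ((resDer H₀).comp A.derivationModule.subtype) (fun θ hθ => ?_) b
  obtain ⟨η, hη⟩ := exists_derivation_eq_smul_of_dvd (definingPoly_ne_zero hH₀)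
    fun x => (resHom_eq_zero_iff hker).mp congr($hθ x)
  refine ⟨⟨η, mem_derivationModule_of_definingPoly_smul_mem hH₀ hA ?_⟩, Subtype.ext hη⟩
  exact hη ▸ θ.2

theorem linearIndependent_of_comp_resHom (hH₀ : IsCoatom H₀) (hA : H₀ ∉ A.hyps) {ι κ : Type*}
    (b : Basis ι (CoordRing K V) A.derivationModule) {f : κ → ι} (hf : Function.Injective f)
    {η : κ → Der K H₀} (hη : ∀ i x, η i (resHom H₀ x) = resHom H₀ ((b (f i) : Der K V) x)) :
    LinearIndependent (CoordRing K H₀) η := by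
  let precomp : Der K H₀ →ₗ[CoordRing K H₀] CoordRing K V → CoordRing K H₀ :=
    { toFun := fun η x => η (resHom H₀ x)
      map_add' := fun _ _ => rfl
      map_smul' := fun _ _ => rfl }
  have hprecomp : precomp ∘ η = (fun i => resDer H₀ (b i : Der K V)) ∘ f :=
    funext fun i => funext (hη i)
  refine .of_comp precomp ?_
  rw [hprecomp]
  exact (linearIndependent_resDer_comp_basis hH₀ hA b).comp f hf

end Restriction

section Counting

variable {A : HypArrangement K V} {ι : Type*} {d : ι → ℕ}

theorem IsHomogDerivation.mem_span_image [Finite ι]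
    (b : Basis ι (CoordRing K V) A.derivationModule)
    (hd : ∀ i, IsHomogDerivation (b i : Der K V) (d i)) {θ : A.derivationModule} {e : ℕ}
    (he : IsHomogDerivation (θ : Der K V) e) :
    θ ∈ Submodule.span (CoordRing K V) (b '' {i | d i ≤ e}) := by
  have := Fintype.ofFinite ι
  have sum_apply : ∀ (c : ι → CoordRing K V) (x : CoordRing K V),
      ((∑ i, c i • b i : A.derivationModule) : Der K V) x = ∑ i, c i * (b i : Der K V) x := by
    intro c x
    rw [AddSubmonoidClass.coe_finsetSum, ← Derivation.coeFnAddMonoidHom_apply, map_sum,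
      Finset.sum_apply]
    rfl
  have hθ : θ = ∑ i, (if d i ≤ e then homogPart (e - d i) (b.repr θ i) else 0) • b i := by
    refine Subtype.ext (der_ext fun α => ?_)
    have hsum := sum_apply (b.repr θ) (linForm K V α)
    rw [b.sum_repr] at hsum
    rw [sum_apply, ← homogPart_of_mem (he α), hsum, map_sum]
    simp only [homogPart_mul_of_mem _ (hd _ α), ite_mul, zero_mul]
  rw [hθ]
  refine Submodule.sum_mem _ fun i _ => ?_
  split_ifs with hi
  · exact Submodule.smul_mem _ _ (Submodule.subset_span ⟨i, hi, rfl⟩)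
  · rw [zero_smul]
    exact Submodule.zero_mem _

theorem card_le_card_of_linearIndependent_of_isHomogDerivation [Fintype ι]
    (b : Basis ι (CoordRing K V) A.derivationModule)
    (hd : ∀ i, IsHomogDerivation (b i : Der K V) (d i)) {κ : Type*} [Fintype κ]
    {v : κ → A.derivationModule} (hv : LinearIndependent (CoordRing K V) v) {n : ℕ} {e : κ → ℕ}
    (he : ∀ j, IsHomogDerivation (v j : Der K V) (e j)) (hen : ∀ j, e j ≤ n) :
    Fintype.card κ ≤ (Finset.univ.filter fun i => d i ≤ n).card := by
  classical
  have hspan : Set.range v ≤ Submodule.span (CoordRing K V)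
      ((Finset.univ.filter fun i => d i ≤ n).image b : Set A.derivationModule) := by
    rintro _ ⟨j, rfl⟩
    refine Submodule.span_mono ?_ ((he j).mem_span_image b hd)
    rintro _ ⟨i, hi, rfl⟩
    exact Finset.mem_coe.mpr (Finset.mem_image_of_mem b (by simpa using hi.trans (hen j)))
  have hcard := linearIndependent_le_span_aux' v hv _ hspan
  simp only [Finset.coe_sort_coe, Fintype.card_coe] at hcard
  exact hcard.trans Finset.card_image_le

theorem exists_resHom_basis_ne_zero [Fintype ι] {H₀ : Submodule K V} (hH₀ : H₀ ∈ A.hyps)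
    (b : Basis ι (CoordRing K V) (A.deletion H₀).derivationModule)
    (hd : ∀ i, IsHomogDerivation (b i : Der K V) (d i)) {κ : Type*} [Fintype κ]
    (c : Basis κ (CoordRing K H₀) (A.restriction H₀).derivationModule) {e : κ → ℕ}
    (he : ∀ j, IsHomogDerivation (c j : Der K H₀) (e j)) {n : ℕ}
    (hlt : (Finset.univ.filter fun j => e j ≤ n).card <
      (Finset.univ.filter fun i => d i ≤ n).card) :
    ∃ k, d k ≤ n ∧ resHom H₀ ((b k : Der K V) (definingPoly H₀)) ≠ 0 := by
  by_contra! hzero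
  have hmem : ∀ i : {i // d i ≤ n}, (b i : Der K V) ∈ A.derivationModule := fun i =>
    (mem_derivationModule_iff_deletion hH₀).mpr ⟨(b i).2, hzero i i.2⟩
  choose η hη using fun i => exists_der_comp_resHom_eq (hmem i) hH₀
  have hη_mem := fun i => mem_derivationModule_restriction_of_comp_resHom (hmem i) (hη i)
  have hη_indep : LinearIndependent (CoordRing K H₀) η :=
    linearIndependent_of_comp_resHom (A.isCoatom H₀ hH₀) notMem_deletion_hyps b
      Subtype.val_injective hη
  have hcard := card_le_card_of_linearIndependent_of_isHomogDerivation c he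
    (v := fun i => ⟨η i, hη_mem i⟩) (.of_comp (Submodule.subtype _) hη_indep)
    (fun i => isHomogDerivation_of_comp_resHom (hη i) (hd i)) (fun i => i.2)
  rw [Fintype.card_subtype] at hcard
  exact hcard.not_gt hlt

end Counting

section Addition

variable {A : HypArrangement K V} {H₀ : Submodule K V}

theorem IsHomogDerivation.smul {θ : Der K V} {x : CoordRing K V} {m n : ℕ}
    (hx : x ∈ homogComponent K V m) (hθ : IsHomogDerivation θ n) :
    IsHomogDerivation (x • θ) (m + n) := fun α => mul_mem_homogComponent hx (hθ α)

theorem IsHomogDerivation.sub {θ η : Der K V} {n : ℕ} (hθ : IsHomogDerivation θ n)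
    (hη : IsHomogDerivation η n) : IsHomogDerivation (θ - η) n := fun α =>
  Submodule.sub_mem _ (hθ α) (hη α)

theorem exists_basis_derivationModule_of_deletion (hH₀ : H₀ ∈ A.hyps) {ι : Type*}
    (b : Basis ι (CoordRing K V) (A.deletion H₀).derivationModule) {k : ι}
    (hk : resHom H₀ ((b k : Der K V) (definingPoly H₀)) ≠ 0) {g : ι → CoordRing K V}
    (hg : ∀ j, resHom H₀ ((b j : Der K V) (definingPoly H₀)) =
      resHom H₀ (g j) * resHom H₀ ((b k : Der K V) (definingPoly H₀))) :
    ∃ b' : Basis ι (CoordRing K V) A.derivationModule,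
      (b' k : Der K V) = definingPoly H₀ • (b k : Der K V) ∧
        ∀ j ≠ k, (b' j : Der K V) = b j - g j • (b k : Der K V) := by
  have hHc := A.isCoatom H₀ hH₀
  have hle : A.derivationModule ≤ (A.deletion H₀).derivationModule := fun θ hθ =>
    ((mem_derivationModule_iff_deletion hH₀).mp hθ).1
  let f := (LinearMap.proj (definingPoly H₀)).comp
    ((resDer H₀).comp (A.deletion H₀).derivationModule.subtype)
  have hf : Function.Exact (Submodule.inclusion hle) f := fun θ => by
    rw [← LinearMap.coe_range, Submodule.range_inclusion]
    exact ⟨fun h => (mem_derivationModule_iff_deletion hH₀).mpr ⟨θ.2, h⟩,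
      fun h => ((mem_derivationModule_iff_deletion hH₀).mp h).2⟩
  obtain ⟨b', hb'k, hb'j⟩ := exists_basis_of_exact_semilinear (f := f) (definingPoly_ne_zero hHc)
    (fun x => resHom_eq_zero_iff (ker_definingForm hHc)) (Submodule.inclusion_injective hle) hf b
    hk hg
  exact ⟨b', congr(Subtype.val $hb'k), fun j hj => congr(Subtype.val $(hb'j j hj))⟩

theorem exists_homogeneous_basis_derivationModule_of_deletion (hH₀ : H₀ ∈ A.hyps) {ι : Type*}
    [DecidableEq ι] (b : Basis ι (CoordRing K V) (A.deletion H₀).derivationModule) {d : ι → ℕ}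
    (hd : ∀ i, IsHomogDerivation (b i : Der K V) (d i)) {k : ι}
    (hk : resHom H₀ ((b k : Der K V) (definingPoly H₀)) ≠ 0)
    (hdvd : ∀ j, resHom H₀ ((b k : Der K V) (definingPoly H₀)) ∣
      resHom H₀ ((b j : Der K V) (definingPoly H₀))) :
    ∃ b' : Basis ι (CoordRing K V) A.derivationModule,
      ∀ j, IsHomogDerivation (b' j : Der K V) (Function.update d k (d k + 1) j) := by
  have quotient : ∀ j, ∃ g, IsHomogDerivation (g • (b k : Der K V)) (d j) ∧
      resHom H₀ ((b j : Der K V) (definingPoly H₀)) =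
        resHom H₀ g * resHom H₀ ((b k : Der K V) (definingPoly H₀)) := by
    intro j
    by_cases hj : resHom H₀ ((b j : Der K V) (definingPoly H₀)) = 0
    · exact ⟨0, fun α => by simp, by rw [hj, map_zero, zero_mul]⟩
    · obtain ⟨e, he, z, hz, hzmul⟩ := exists_homogComponent_mul_eq_of_dvd
        (pullback_mem_homogComponent _ (hd k _)) (pullback_mem_homogComponent _ (hd j _))
        (hdvd j) hj
      obtain ⟨g, hg, rfl⟩ := exists_homogComponent_resHom_eq hz
      exact ⟨g, he ▸ .smul hg (hd k), hzmul.symm⟩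
  choose g hg_homog hg using quotient
  obtain ⟨b', hb'k, hb'j⟩ := exists_basis_derivationModule_of_deletion hH₀ b hk hg
  refine ⟨b', fun j => ?_⟩
  rcases eq_or_ne j k with rfl | hj
  · rw [hb'k, Function.update_self, add_comm]
    exact .smul (linForm_mem_homogComponent _) (hd j)
  · rw [hb'j j hj, Function.update_of_ne hj]
    exact (hd j).sub (hg_homog j)

theorem IsFreeWithExponents.of_deletion_of_restriction (hH₀ : H₀ ∈ A.hyps) {n : ℕ}
    {B : CoordRing K H₀} (hB : B ∈ homogComponent K H₀ n)
    (hdvd : ∀ θ ∈ (A.deletion H₀).derivationModule, B ∣ resHom H₀ (θ (definingPoly H₀)))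
    {m : Multiset ℕ} (hres : (A.restriction H₀).IsFreeWithExponents m)
    (hdel : (A.deletion H₀).IsFreeWithExponents (n ::ₘ m)) :
    A.IsFreeWithExponents ((n + 1) ::ₘ m) := by
  obtain ⟨b, d, hd, hm⟩ := hdel
  obtain ⟨c, e, he, rfl⟩ := hres
  have hlt : (Finset.univ.filter fun j => e j ≤ n).card <
      (Finset.univ.filter fun i => d i ≤ n).card := by
    have hcount := congr(Multiset.countP (· ≤ n) $hm)
    rw [Multiset.countP_cons_of_pos (p := (· ≤ n)) _ le_rfl, Multiset.countP_map,
      Multiset.countP_map] at hcount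
    exact Nat.lt_of_succ_le hcount.le
  obtain ⟨k, hkn, hk⟩ := exists_resHom_basis_ne_zero hH₀ b hd c he hlt
  obtain ⟨r, hr, z, hz, hzmul⟩ := exists_homogComponent_mul_eq_of_dvd hB
    (pullback_mem_homogComponent _ (hd k _)) (hdvd _ (b k).2) hk
  obtain rfl : r = 0 := by omega
  obtain rfl : d k = n := by omega
  obtain ⟨a, rfl⟩ := mem_homogComponent_zero.mp hz
  have ha : a ≠ 0 := by
    rintro rfl
    exact hk (by rw [← hzmul, map_zero, zero_mul])
  have hunit : IsUnit (algebraMap K (CoordRing K H₀) a) := ha.isUnit.map _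
  obtain ⟨b', hb'⟩ := exists_homogeneous_basis_derivationModule_of_deletion hH₀ b hd hk fun j => by
    rw [← hzmul, hunit.mul_left_dvd]
    exact hdvd _ (b j).2
  exact ⟨b', _, hb', (map_update_eq_cons_of_map_eq_cons hm.symm _).symm⟩

end Addition

section Divisibility

variable {A : HypArrangement K V} {H₀ : Submodule K V} {θ : Der K V}

theorem definingPoly_dvd_der_sub {H₁ H : Submodule K V} (hH₀ : IsCoatom H₀) (hH₁ : IsCoatom H₁)
    (hH : IsCoatom H) (hne : H₁ ≠ H) (hle : H₀ ⊓ H₁ ≤ H) (hθ : definingPoly H ∣ θ (definingPoly H))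
    {g : CoordRing K V} (hg : θ (definingPoly H₁) = definingPoly H₁ * g) :
    definingPoly H ∣ θ (definingPoly H₀) - definingPoly H₀ * g := by
  rw [← ker_definingForm hH₀, ← ker_definingForm hH₁, ← ker_definingForm hH] at hle
  obtain ⟨c, d, hform⟩ := exists_eq_smul_add_smul_of_ker_inf_ker_le hle
  have hc : c ≠ 0 := by
    rintro rfl
    refine not_le_of_isCoatom_of_ne hH₁ hH hne fun x hx => ?_
    rw [← ker_definingForm hH₁, LinearMap.mem_ker] at hx
    rw [← ker_definingForm hH, LinearMap.mem_ker, hform]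
    simp [hx]
  have hpoly : definingPoly H = c • definingPoly H₀ + d • definingPoly H₁ := by
    rw [definingPoly, hform, map_add, map_smul, map_smul]
  have hsub : θ (definingPoly H) - definingPoly H * g =
      c • (θ (definingPoly H₀) - definingPoly H₀ * g) := by
    rw [hpoly, map_add, Derivation.map_smul, Derivation.map_smul, hg, add_mul, smul_mul_assoc,
      smul_mul_assoc, add_sub_add_right_eq_sub, ← smul_sub]
  have hdvd := dvd_smul_of_dvd c⁻¹ (hsub ▸ dvd_sub hθ (dvd_mul_right (definingPoly H) g))
  rwa [inv_smul_smul₀ hc] at hdvd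

theorem prod_resHom_dvd_of_inf_le (hH₀ : IsCoatom H₀) (hθ : θ ∈ A.derivationModule)
    {F : Finset (Submodule K V)} (hF : F ⊆ A.hyps) {H₁ : Submodule K V} (hH₁ : H₁ ∈ A.hyps)
    (hH₁F : H₁ ∉ F) (hle : ∀ H ∈ F, H₀ ⊓ H₁ ≤ H) :
    ∏ H ∈ F, resHom H₀ (definingPoly H) ∣ resHom H₀ (θ (definingPoly H₀)) := by
  rw [mem_derivationModule_iff] at hθ
  have hcoatom : ∀ H ∈ F, IsCoatom H := fun H hH => A.isCoatom H (hF hH)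
  obtain ⟨g, hg⟩ := hθ H₁ hH₁
  have hdvd : ∏ H ∈ F, definingPoly H ∣ θ (definingPoly H₀) - definingPoly H₀ * g := by
    refine Finset.prod_dvd_of_isRelPrime (fun H hH H' hH' hne => ?_) fun H hH =>
      definingPoly_dvd_der_sub hH₀ (A.isCoatom H₁ hH₁) (hcoatom H hH)
        (ne_of_mem_of_not_mem hH hH₁F).symm (hle H hH) (hθ H (hF hH)) hg
    have hker := ker_definingForm (hcoatom H hH)
    have hker' := ker_definingForm (hcoatom H' hH')
    refine isRelPrime_linForm ?_ ?_ ?_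
    · simpa only [hker] using hcoatom H hH
    · simpa only [hker'] using hcoatom H' hH'
    · rwa [hker, hker']
  have hres := map_dvd (resHom H₀) hdvd
  rwa [map_prod, map_sub, map_mul, (resHom_eq_zero_iff (ker_definingForm hH₀)).mpr dvd_rfl,
    zero_mul, sub_zero] at hres

theorem isRelPrime_resHom_definingPoly {H H' : Submodule K V} (hH : IsCoatom H)
    (hH' : IsCoatom H') (hle : ¬ H₀ ≤ H) (hle' : ¬ H₀ ≤ H')
    (hne : H.comap H₀.subtype ≠ H'.comap H₀.subtype) :
    IsRelPrime (resHom H₀ (definingPoly H)) (resHom H₀ (definingPoly H')) := by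
  have hker : ∀ {H : Submodule K V}, IsCoatom H →
      LinearMap.ker (definingForm H ∘ₗ H₀.subtype) = H.comap H₀.subtype := fun hH => by
    rw [LinearMap.ker_comp, ker_definingForm hH]
  rw [pullback_linForm, pullback_linForm]
  refine isRelPrime_linForm ?_ ?_ ?_
  · exact hker hH ▸ isCoatom_comap_subtype hH hle
  · exact hker hH' ▸ isCoatom_comap_subtype hH' hle'
  · rwa [hker hH, hker hH']

theorem prod_resHom_dvd_of_forall_exists_comap_eq (hH₀ : IsCoatom H₀) (hA : H₀ ∉ A.hyps)
    (hθ : θ ∈ A.derivationModule) {Q : Finset (Submodule K V)} (hQ : Q ⊆ A.hyps)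
    (h : ∀ H ∈ Q, ∃ H₁ ∈ A.hyps, H₁ ∉ Q ∧ H₁.comap H₀.subtype = H.comap H₀.subtype) :
    ∏ H ∈ Q, resHom H₀ (definingPoly H) ∣ resHom H₀ (θ (definingPoly H₀)) := by
  classical
  have hle : ∀ H ∈ Q, ¬ H₀ ≤ H := fun H hH => not_le_of_isCoatom_of_ne hH₀
    (A.isCoatom H (hQ hH)) (ne_of_mem_of_not_mem (hQ hH) hA).symm
  rw [← Finset.prod_fiberwise_of_maps_to fun H hH =>
    Finset.mem_image_of_mem (fun H => H.comap H₀.subtype) hH]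
  refine Finset.prod_dvd_of_isRelPrime (fun Y _ Y' _ hne => ?_) fun Y hY => ?_
  · refine IsRelPrime.prod_left fun H hHY => IsRelPrime.prod_right fun H' hHY' => ?_
    obtain ⟨hH, rfl⟩ := Finset.mem_filter.mp hHY
    obtain ⟨hH', rfl⟩ := Finset.mem_filter.mp hHY'
    exact isRelPrime_resHom_definingPoly (A.isCoatom H (hQ hH)) (A.isCoatom H' (hQ hH'))
      (hle H hH) (hle H' hH') hne
  · obtain ⟨H₂, hH₂, rfl⟩ := Finset.mem_image.mp hY
    obtain ⟨H₁, hH₁, hH₁Q, hcomap⟩ := h H₂ hH₂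
    refine prod_resHom_dvd_of_inf_le hH₀ hθ ((Finset.filter_subset _ _).trans hQ) hH₁
      (fun hmem => hH₁Q (Finset.mem_filter.mp hmem).1) fun H hH x hx => ?_
    have hHY := (Finset.mem_filter.mp hH).2.trans hcomap.symm
    exact (SetLike.ext_iff.mp hHY ⟨x, hx.1⟩).mpr hx.2

end Divisibility

section Factorization

theorem IsFreeWithExponents.of_surjOn {A : HypArrangement K V} [DecidableEq (Submodule K V)]
    {P : Finset (Submodule K V)} (hP : P ⊆ A.hyps) {H₀ : Submodule K V} (hH₀ : H₀ ∈ P)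
    (hsurj : Set.SurjOn (fun H : Submodule K V => H.comap H₀.subtype) ↑(A.hyps \ P)
      (A.restriction H₀).hyps)
    {m : Multiset ℕ} (hres : (A.restriction H₀).IsFreeWithExponents m)
    (hdel : (A.deletion H₀).IsFreeWithExponents ((P.erase H₀).card ::ₘ m)) :
    A.IsFreeWithExponents (P.card ::ₘ m) := by
  have hH₀c := A.isCoatom H₀ (hP hH₀)
  rw [← Finset.card_erase_add_one hH₀]
  refine .of_deletion_of_restriction (hP hH₀)
    (B := ∏ H ∈ P.erase H₀, resHom H₀ (definingPoly H)) ?_ (fun θ hθ => ?_) hres hdel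
  · simp only [pullback_linForm]
    exact prod_linForm_mem_homogComponent _ _
  refine prod_resHom_dvd_of_forall_exists_comap_eq hH₀c notMem_deletion_hyps hθ
    (fun H hH => ?_) fun H hH => ?_
  all_goals obtain ⟨hne, hHP⟩ := Finset.mem_erase.mp hH
  · exact mem_deletion_hyps.mpr ⟨hne, hP hHP⟩
  · have hle := not_le_of_isCoatom_of_ne hH₀c (A.isCoatom H (hP hHP)) hne.symm
    obtain ⟨H₁, hH₁, hcomap⟩ := hsurj (mem_restriction_hyps.mpr ⟨H, hP hHP, hle, rfl⟩)
    obtain ⟨hH₁A, hH₁P⟩ := Finset.mem_sdiff.mp hH₁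
    exact ⟨H₁, mem_deletion_hyps.mpr ⟨(ne_of_mem_of_not_mem hH₀ hH₁P).symm, hH₁A⟩,
      fun h => hH₁P (Finset.mem_of_mem_erase h), hcomap⟩

theorem IsFreeWithExponents.card_eq {A : HypArrangement K V} {m : Multiset ℕ}
    (h : A.IsFreeWithExponents m) : m.card = finrank K V := by
  obtain ⟨_, d, _, rfl⟩ := h
  simp

theorem der_ext_of_basis {ι : Type*} (b : Basis ι K (Dual K V)) {θ η : Der K V}
    (h : ∀ i, θ (linForm K V (b i)) = η (linForm K V (b i))) : θ = η := by
  have heq : θ.toLinearMap ∘ₗ linForm K V = η.toLinearMap ∘ₗ linForm K V := b.ext h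
  exact der_ext fun α => congr($heq α)

theorem isHomogDerivation_of_basis {ι : Type*} (b : Basis ι K (Dual K V)) {θ : Der K V} {n : ℕ}
    (h : ∀ i, θ (linForm K V (b i)) ∈ homogComponent K V n) : IsHomogDerivation θ n := fun α => by
  have hspan : Submodule.span K (Set.range b) ≤
      (homogComponent K V n).comap (θ.toLinearMap ∘ₗ linForm K V) :=
    Submodule.span_le.mpr (Set.range_subset_iff.mpr h)
  exact hspan (b.mem_span α)

/-- The derivation of `S(V*)` with prescribed values on the members of a basis of `V*`. -/
noncomputable def mkDer {ι : Type*} (b : Basis ι K (Dual K V)) (g : ι → CoordRing K V) : Der K V :=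
  Derivation.mk' ((coordEquiv b).symm.toLinearMap ∘ₗ
    (MvPolynomial.mkDerivation K fun i => coordEquiv b (g i)).toLinearMap ∘ₗ
    (coordEquiv b).toLinearMap) fun x y => by simp

@[simp]
theorem mkDer_linForm {ι : Type*} (b : Basis ι K (Dual K V)) (g : ι → CoordRing K V) (i : ι) :
    mkDer b g (linForm K V (b i)) = g i := by
  change (coordEquiv b).symm (MvPolynomial.mkDerivation K _ (coordEquiv b _)) = g i
  simp

/-- The coordinates of a derivation of `S(V*)`: its values on the members of a basis of `V*`. -/
noncomputable def derEquivFun {ι : Type*} (b : Basis ι K (Dual K V)) :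
    Der K V ≃ₗ[CoordRing K V] (ι → CoordRing K V) where
  toFun θ i := θ (linForm K V (b i))
  map_add' _ _ := rfl
  map_smul' _ _ := rfl
  invFun := mkDer b
  left_inv _ := der_ext_of_basis b fun i => mkDer_linForm b _ i
  right_inv g := funext fun i => mkDer_linForm b g i

theorem isFreeWithExponents_empty (K : Type u) [Field K] (V : Type v) [AddCommGroup V] [Module K V]
    [FiniteDimensional K V] :
    (HypArrangement.empty K V).IsFreeWithExponents (Multiset.replicate (finrank K V) 0) := by
  have htop : (HypArrangement.empty K V).derivationModule = ⊤ :=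
    eq_top_iff.mpr fun θ _ H hH => absurd hH (Finset.notMem_empty H)
  let x := (finBasis K V).dualBasis
  let b := (Basis.ofEquivFun (derEquivFun x)).map (LinearEquiv.ofTop _ htop).symm
  have hb : ∀ i, (b i : Der K V) = mkDer x (Pi.single i 1) := fun i => by
    simp only [b, Basis.map_apply, Basis.coe_ofEquivFun]
    rfl
  refine ⟨b, fun _ => 0, fun i => isHomogDerivation_of_basis x fun j => ?_, by simp⟩
  rw [hb, mkDer_linForm, Pi.single_apply, mem_homogComponent_zero]
  split_ifs
  · exact ⟨1, map_one _⟩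
  · exact ⟨0, map_zero _⟩

theorem finrank_add_one_of_isCoatom [FiniteDimensional K V] {H : Submodule K V}
    (hH : IsCoatom H) : finrank K H + 1 = finrank K V := by
  have hker := Module.Dual.finrank_ker_add_one_of_ne_zero (definingForm_ne_zero hH)
  rwa [ker_definingForm hH] at hker

open scoped Classical in
theorem IsInductiveFactorization.isInductivelyFree_and_isFreeWithExponents {K : Type u} [Field K]
    {V : Type v} [AddCommGroup V] [Module K V] [FiniteDimensional K V] {A : HypArrangement K V}
    {π : Finpartition A.hyps} (h : IsInductiveFactorization A π) :
    A.IsInductivelyFree ∧ A.IsFreeWithExponents (blockSizes π.parts (finrank K V)) := by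
  induction h with
  | @empty V _ _ _ π =>
    have hπ : π.parts = ∅ := Finpartition.parts_eq_empty_iff.mpr rfl
    exact ⟨.empty, hπ ▸ blockSizes_empty _ ▸ isFreeWithExponents_empty K V⟩
  | @add V _ _ _ A π P₁ block H₀ mem bij π' parts_del _ π'' parts_res _ ih_del ih_res =>
    obtain ⟨free_del, exp_del⟩ := ih_del
    obtain ⟨free_res, exp_res⟩ := ih_res
    have hP₁ : P₁ ⊆ A.hyps := π.le block
    have hdim : finrank K H₀ + 1 = finrank K V :=
      finrank_add_one_of_isCoatom (A.isCoatom H₀ (hP₁ mem))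
    have sizes_res : blockSizes π''.parts (finrank K H₀) =
        blockSizes (π.parts.erase P₁) (finrank K H₀) := by
      rw [parts_res]
      refine blockSizes_image_image bij.injOn (fun P hP => ?_) _
      obtain ⟨hne, hP⟩ := Finset.mem_erase.mp hP
      exact Finset.subset_sdiff.mpr ⟨π.le hP, π.disjoint hP block hne⟩
    rw [sizes_res] at exp_res
    have hr := card_le_of_card_blockSizes exp_res.card_eq
    have sizes_del : blockSizes π'.parts (finrank K V) =
        (P₁.erase H₀).card ::ₘ blockSizes (π.parts.erase P₁) (finrank K H₀) := by
      rw [← hdim, parts_del]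
      exact blockSizes_image_inter_erase_parts block mem hr
    rw [sizes_del] at exp_del
    rw [← hdim, blockSizes_parts_succ block hr]
    exact ⟨.add A H₀ (hP₁ mem) free_del free_res _ _ exp_del exp_res (Multiset.le_cons_self _ _),
      .of_surjOn hP₁ mem bij.surjOn exp_res exp_del⟩

theorem IsInductivelyFactored.isInductivelyFree [FiniteDimensional K V] {A : HypArrangement K V}
    (h : A.IsInductivelyFactored) : A.IsInductivelyFree := by
  obtain ⟨π, hπ⟩ := h
  exact hπ.isInductivelyFree_and_isFreeWithExponents.1

end Factorization

end HypArrangement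

theorem mainTheorem10 {K : Type u} [Field K] {V : Type v} [AddCommGroup V] [Module K V]
    [FiniteDimensional K V] (A : HypArrangement K V)
    (hA : A.IsHereditarilyInductivelyFactored) :
    A.IsHereditarilyInductivelyFree := by
  intro X hX
  exact (hA X hX).isInductivelyFree
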